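/- Let $\mathbb{F}_q$ be a finite field with $q$ elements, let $n,m$ be non-negative integers, and write $\mathbb{F}_q^{n\times m}$ for the set of $n\times m$ matrices over $\mathbb{F}_q$, $\mathbb{F}_q^{n\times m,r}$ for the set of those of rank $r$, and $\mathrm{row}(M)\subseteq\mathbb{F}_q^m$ for the row space of $M$. Let $\mathcal{R}$ be a probability distribution on $\{0,1,\dots,\min\{n,m\}\}$. The Gamma channel $\Gamma(\mathcal{R})$ has input and output set $\mathbb{F}_q^{n\times m}$ and channel law $\boldsymbol{Y}=\boldsymbol{A}(\boldsymbol{X}+\boldsymbol{B})$, where $\boldsymbol{A}$ and $\boldsymbol{B}$ are independent of each other and of the input $\boldsymbol{X}$, $\boldsymbol{A}$ is uniform on $\mathrm{GL}(n,q)$, and $\boldsymbol{B}$ takes each value $M$ with probability $\mathcal{R}(\mathrm{rank}\,M)/|\mathbb{F}_q^{n\times m,\mathrm{rank}\,M}|$. Its capacity is $C=\max_{\mathcal{P}_{\boldsymbol X}} I(\boldsymbol{X};\boldsymbol{Y})$, over all probability distributions $\mathcal{P}_{\boldsymbol X}$ of the input $\boldsymbol X$ on $\mathbb{F}_q^{n\times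 m}$. Logarithms are to any fixed base $b>1$, and terms with weight $0$ are read as $0$ (so $0\log 0=0$ and $0\log(c/0)=0$). The following numbers depend only on $q,n,m$ and the displayed arguments: * $f_0(u)$, the number of $M\in\mathbb{F}_q^{n\times m}$ with $\mathrm{row}(M)=U$, where $U$ is a fixed subspace of $\mathbb{F}_q^m$ of dimension $u$; * $f_1(u,v,h;r)$, the number of $B\in\mathbb{F}_q^{n\times m,r}$ with $\mathrm{row}(M+B)=V$, where $M\in\mathbb{F}_q^{n\times m}$ is a fixed matrix of rank $u$ and $V$ a fixed subspace of $\mathbb{F}_q^m$ of dimension $v$ with $\dim\big((\mathrm{row}(M)+V)/V\big)=h$; * $f_2(r,r_X,r_B)$, the number of $B\in\mathbb{F}_q^{n\times m,r_B}$ with $\mathrm{rank}(X+B)=r$, where $X\in\mathbb{F}_q^{n\times m}$ is a fixed matrix of rank $r_X$ (each is set to $0$ for arguments for which there is no such configuration). Let $\left[{a\atop d}\right]_q=\prod_{i=0}^{d-1}\frac{q^a-q^i}{q^d-q^i}$ for $0\le d\le a$, and $\left[{a\atop d}\right]_q=0$ for all other integers $d$. For a probability distribution $\mathcal{R}_{\boldsymbol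 X}$ on $\{0,\dots,\min\{n,m\}\}$ put $$\sigma(r_Y)=\sum_{r_X,r_B=0}^{\min\{n,m\}}\mathcal{R}_{\boldsymbol X}(r_X)\,\mathcal{R}(r_B)\,\frac{f_2(r_Y,r_X,r_B)}{|\mathbb{F}_q^{n\times m,r_B}|},\qquad \pi(r,u,h)=\sum_{r_B=0}^{\min\{n,m\}}\mathcal{R}(r_B)\,\frac{f_1(r,u,h;r_B)}{|\mathbb{F}_q^{n\times m,r_B}|}.$$ Then the maximum that defines $C$ is attained, and $$C=\max_{\mathcal{R}_{\boldsymbol X}}\left\{-\sum_{r_Y=0}^{\min\{n,m\}}\sigma(r_Y)\log\left(\frac{\sigma(r_Y)}{|\mathbb{F}_q^{n\times m,r_Y}|}\right)-\sum_{r=0}^{\min\{n,m\}}\mathcal{R}_{\boldsymbol X}(r)\sum_{u=0}^{\min\{n,m\}}\sum_{h=0}^{r}q^{(u-r+h)h}\left[{m-r\atop u-r+h}\right]_q\left[{r\atop r-h}\right]_q\pi(r,u,h)\log\left(\frac{f_0(u)}{\pi(r,u,h)}\right)\right\},$$ where the maximum is over all probability distributions $\mathcal{R}_{\boldsymbol X}$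 on $\{0,\dots,\min\{n,m\}\}$ and is attained. -/

import Mathlib

noncomputable section

namespace GammaChannel

theorem rank_lt {F : Type*} [Field F] {n m : ℕ} (M : Matrix (Fin n) (Fin m) F) :
    M.rank < min n m + 1 :=
  Nat.lt_succ_of_le (le_min M.rank_le_height M.rank_le_width)

variable (F : Type*) [Field F] [Fintype F] [DecidableEq F] (n m : ℕ)

/-- The row space of a matrix. -/
def rowSpace {F : Type*} [Field F] {n m : ℕ} (M : Matrix (Fin n) (Fin m) F) :
    Submodule F (Fin m → F) :=
  Submodule.span F (Set.range M.row)

/-- The number of `n × m` matrices over `F` of rank `r`. -/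
def numRank (r : ℕ) : ℕ :=
  Nat.card {M : Matrix (Fin n) (Fin m) F // M.rank = r}

/-- The set of probability distributions on `{0, 1, …, min n m}`, the possible ranks. -/
def rankDists : Set (Fin (min n m + 1) → ℝ) := stdSimplex ℝ (Fin (min n m + 1))

variable {F n m}

/-- The uniform-given-rank distribution on matrices with rank distribution `R`:
a matrix `M` has probability `R(rank M)` divided by the number of matrices of that rank. -/
def ugr (R : Fin (min n m + 1) → ℝ) (M : Matrix (Fin n) (Fin m) F) : ℝ :=
  R ⟨M.rank, rank_lt M⟩ / numRank F n m M.rank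

/-- The law of the Gamma channel with rank error distribution `R`: `channelLaw R X Y` is the
probability that `A (X + B) = Y`, where `A` is uniform on `GL(n, F)`, `B` is
uniform given rank with rank distribution `R`, and `A`, `B` are independent. -/
def channelLaw (R : Fin (min n m + 1) → ℝ) (X Y : Matrix (Fin n) (Fin m) F) : ℝ :=
  ∑ A : GL (Fin n) F, ∑ B : Matrix (Fin n) (Fin m) F,
    (1 / (Fintype.card (GL (Fin n) F) : ℝ)) * ugr R B *
      (if (A : Matrix (Fin n) (Fin n) F) * (X + B) = Y then 1 else 0)

/-- The distribution of the channel output `Y` when the input has distribution `P`. -/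
def outputDist (R : Fin (min n m + 1) → ℝ) (P : Matrix (Fin n) (Fin m) F → ℝ)
    (Y : Matrix (Fin n) (Fin m) F) : ℝ :=
  ∑ X, P X * channelLaw R X Y

/-- The mutual information `I(X; Y)`, with logarithms to base `b`, of the input and the output
of the Gamma channel when the input has distribution `P`:
`∑ p(x, y) log (p(x, y) / (p(x) p(y)))`, where terms with `p(x, y) = 0` vanish. -/
def mutualInfo (b : ℝ) (R : Fin (min n m + 1) → ℝ) (P : Matrix (Fin n) (Fin m) F → ℝ) : ℝ :=
  ∑ X, ∑ Y, (P X * channelLaw R X Y) *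
    Real.logb b ((P X * channelLaw R X Y) / (P X * outputDist R P Y))

variable (F n m)

/-- The values of the mutual information over all input distributions on the matrices. -/
def mutualInfoValues (b : ℝ) (R : Fin (min n m + 1) → ℝ) : Set ℝ :=
  mutualInfo (F := F) b R '' stdSimplex ℝ (Matrix (Fin n) (Fin m) F)

/-- The capacity of the Gamma channel: the supremum of the mutual information over all
input distributions (that it is a maximum is a part of the theorem). -/
def capacity (b : ℝ) (R : Fin (min n m + 1) → ℝ) : ℝ :=
  sSup (mutualInfoValues F n m b R)

/-! ### Counting functions -/

/-- The number of `n × m` matrices with row space `U`. -/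
def count0 (U : Submodule F (Fin m → F)) : ℕ :=
  Nat.card {M : Matrix (Fin n) (Fin m) F // rowSpace M = U}

/-- The number of `n × m` matrices `B` of rank `r` such that `M + B` has row space `V`. -/
def count1 (M : Matrix (Fin n) (Fin m) F) (V : Submodule F (Fin m → F)) (r : ℕ) : ℕ :=
  Nat.card {B : Matrix (Fin n) (Fin m) F // B.rank = r ∧ rowSpace (M + B) = V}

/-- The number of `n × m` matrices `B` of rank `rB` such that `X + B` has rank `r`. -/
def count2 (X : Matrix (Fin n) (Fin m) F) (r rB : ℕ) : ℕ :=
  Nat.card {B : Matrix (Fin n) (Fin m) F // B.rank = rB ∧ (X + B).rank = r}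

/-- The dimension of `(U + V) / V`, the image of `U` in the quotient by `V`. -/
def quotDim {F : Type*} [Field F] {m : ℕ} (U V : Submodule F (Fin m → F)) : ℕ :=
  Module.finrank F (U.map V.mkQ)

open Classical in
/-- `f0 u` is the number of matrices whose row space is a given subspace of dimension `u`
(any one; the value is `0` if there is no such subspace). -/
def f0 (u : ℕ) : ℕ :=
  if h : ∃ U : Submodule F (Fin m → F), Module.finrank F U = u then
    count0 F n m h.choose
  else 0

open Classical in
/-- `f1 u v h r` is the number of matrices `B` of rank `r` such that `M + B` has row space `V`,
for a given matrix `M` of rank `u` and a given subspace `V` of dimension `v` for which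
`(row(M) + V) / V` has dimension `h` (any such pair; the value is `0` if there is none). -/
def f1 (u v h r : ℕ) : ℕ :=
  if hp : ∃ p : Matrix (Fin n) (Fin m) F × Submodule F (Fin m → F),
      Module.finrank F (rowSpace p.1) = u ∧ Module.finrank F p.2 = v ∧
        quotDim (rowSpace p.1) p.2 = h then
    count1 F n m hp.choose.1 hp.choose.2 r
  else 0

open Classical in
/-- `f2 r rX rB` is the number of matrices `B` of rank `rB` such that `X + B` has rank `r`,
for a given matrix `X` of rank `rX` (any one; the value is `0` if there is none). -/
def f2 (r rX rB : ℕ) : ℕ :=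
  if h : ∃ X : Matrix (Fin n) (Fin m) F, X.rank = rX then
    count2 F n m h.choose r rB
  else 0

/-! ### The objective function -/

/-- The Gaussian binomial coefficient `[a choose d]_q`; it is `0` unless `0 ≤ d ≤ a`. -/
def gaussBinom (q : ℝ) (a : ℕ) (d : ℤ) : ℝ :=
  if 0 ≤ d ∧ d ≤ a then ∏ i ∈ Finset.range d.toNat, (q ^ a - q ^ i) / (q ^ d.toNat - q ^ i)
  else 0

/-- `∑_{r_X, r_B} R_X(r_X) R(r_B) f2(r_Y, r_X, r_B) / #{matrices of rank r_B}`. -/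
def outRank (R RX : Fin (min n m + 1) → ℝ) (rY : ℕ) : ℝ :=
  ∑ rX : Fin (min n m + 1), ∑ rB : Fin (min n m + 1),
    RX rX * R rB * ((f2 F n m rY rX rB : ℝ) / (numRank F n m rB : ℝ))

/-- `∑_{r_B} R(r_B) f1(r, u, h; r_B) / #{matrices of rank r_B}`. -/
def rowProb (R : Fin (min n m + 1) → ℝ) (r u h : ℕ) : ℝ :=
  ∑ rB : Fin (min n m + 1), R rB * ((f1 F n m r u h rB : ℝ) / (numRank F n m rB : ℝ))

/-- The function of the input rank distribution `RX` that is maximised, with logarithms to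
base `b`. As `Real.logb b 0 = 0`, the terms with weight `0` vanish. The integer power has a
negative exponent only where the Gaussian binomial coefficient next to it is `0`. -/
def objective (b : ℝ) (R RX : Fin (min n m + 1) → ℝ) : ℝ :=
  -(∑ rY ∈ Finset.range (min n m + 1),
      outRank F n m R RX rY *
        Real.logb b (1 / (numRank F n m rY : ℝ) * outRank F n m R RX rY))
  - ∑ r : Fin (min n m + 1), RX r *
      ∑ u ∈ Finset.range (min n m + 1), ∑ h ∈ Finset.range ((r : ℕ) + 1),
        (Fintype.card F : ℝ) ^ (((u : ℤ) - (r : ℕ) + h) * h) *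
          gaussBinom (Fintype.card F) (m - (r : ℕ)) ((u : ℤ) - (r : ℕ) + h) *
          gaussBinom (Fintype.card F) r (((r : ℕ) : ℤ) - h) *
          (rowProb F n m R r u h *
            Real.logb b ((f0 F n m u : ℝ) / rowProb F n m R r u h))

end GammaChannel

end

/-! The mutual information is the entropy of the output minus its conditional entropy given the
input (`mutualInfo_eq`). The channel law is unchanged under `X ↦ A * X * Q`, `Y ↦ A' * Y * Q` with
invertible `A`, `A'`, `Q` (`channelLaw_mulEquiv`), and matrices of equal rank form one orbit.

Given `X`, the output is uniform on each set of matrices with a common row space `V`, and the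
probability of `V` depends only on `rank X`, `dim V` and `dim ((row X + V) / V)`. Grouping the
subspaces by the last two numbers and counting each group (`card_submodule_quotDim`) gives a
conditional entropy that depends on the rank of `X` alone (`sum_channelLaw_mul_logb`).

The rank distribution of the output is likewise determined by that of the input. By Jensen,
spreading the output evenly over each rank class can only raise its entropy, so the mutual
information is at most the objective at the input's rank distribution (`mutualInfo_le_objective`).
An input that is uniform given its rank makes the output uniform given its rank, and equality holds
(`mutualInfo_ugr`). Both maxima therefore coincide, and they exist because the objective is
continuous on a compact simplex.

The counting functions are well defined because the linear group acts transitively on pairs of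
subspaces with prescribed dimensions of both and of the intersection
(`exists_linearEquiv_map_pair`). -/

noncomputable section

namespace GammaChannel

open Module

/-! ### Extending linear maps to automorphisms; transitivity on pairs of subspaces. -/

section LinearAlgebra

variable {K V W E : Type*} [Field K] [AddCommGroup V] [Module K V] [AddCommGroup W] [Module K W]
  [AddCommGroup E] [Module K E]

/-- A linear equivalence between two subspaces of a finite-dimensional space extends to
an automorphism of the space. -/
theorem exists_linearEquiv_extend [FiniteDimensional K E] {S S' : Submodule K E} (e : S ≃ₗ[K] S') :
    ∃ φ : E ≃ₗ[K] E, ∀ x : S, φ x = e x := by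
  obtain ⟨C, hC⟩ := S.exists_isCompl
  obtain ⟨C', hC'⟩ := S'.exists_isCompl
  have h1 := Submodule.finrank_add_eq_of_isCompl hC
  have h2 := Submodule.finrank_add_eq_of_isCompl hC'
  have h3 := e.finrank_eq
  let c : C ≃ₗ[K] C' := LinearEquiv.ofFinrankEq C C' (by omega)
  refine ⟨(Submodule.prodEquivOfIsCompl S C hC).symm ≪≫ₗ (e.prodCongr c) ≪≫ₗ
    Submodule.prodEquivOfIsCompl S' C' hC', fun x => ?_⟩
  simp

theorem exists_linearEquiv_comp_eq_of_injective [FiniteDimensional K E] {f g : V →ₗ[K] E}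
    (hf : Function.Injective f) (hg : Function.Injective g) :
    ∃ φ : E ≃ₗ[K] E, ∀ x, φ (f x) = g x := by
  obtain ⟨φ, hφ⟩ := exists_linearEquiv_extend
    ((LinearEquiv.ofInjective f hf).symm ≪≫ₗ LinearEquiv.ofInjective g hg)
  refine ⟨φ, fun x => ?_⟩
  have h := hφ (LinearEquiv.ofInjective f hf x)
  simpa using h

/-- Lifting `g` through a section of `f` solves the equation but kills `ker g`. Adding an
isomorphism `ker g ≃ ker f`, precomposed with a projection onto `ker g`, restores injectivity
without changing the composite with `f`. -/
theorem exists_linearEquiv_comp_eq_of_range_eq [FiniteDimensional K V] {f g : V →ₗ[K] W}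
    (h : LinearMap.range f = LinearMap.range g) :
    ∃ e : V ≃ₗ[K] V, ∀ x, f (e x) = g x := by
  have hker : finrank K (LinearMap.ker g) = finrank K (LinearMap.ker f) := by
    have h1 := f.finrank_range_add_finrank_ker
    have h2 := g.finrank_range_add_finrank_ker
    rw [h] at h1
    omega
  let e₀ := LinearEquiv.ofFinrankEq _ _ hker
  obtain ⟨s, hs⟩ := LinearMap.exists_rightInverse_of_surjective f.rangeRestrict
    f.range_rangeRestrict
  obtain ⟨p, hp⟩ := LinearMap.exists_leftInverse_of_injective (LinearMap.ker g).subtype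
    (Submodule.ker_subtype _)
  have hg : ∀ x, g x ∈ LinearMap.range f := fun x => h ▸ LinearMap.mem_range_self g x
  let E₁ : V →ₗ[K] V := s.comp (g.codRestrict _ hg) +
    (LinearMap.ker f).subtype.comp (e₀.toLinearMap.comp p)
  have hE : ∀ x, f (E₁ x) = g x := by
    intro x
    have h1 := congrArg Subtype.val (LinearMap.congr_fun hs ⟨g x, hg x⟩)
    have h2 : f (e₀ (p x) : V) = 0 := (e₀ (p x)).2
    simp only [LinearMap.comp_apply, LinearMap.id_apply] at h1
    simp only [E₁, LinearMap.add_apply, map_add, LinearMap.comp_apply, Submodule.subtype_apply,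
      LinearEquiv.coe_coe, h2, add_zero]
    exact h1
  have hinj : Function.Injective E₁ := by
    rw [injective_iff_map_eq_zero]
    intro x hx
    have h1 : g x = 0 := by rw [← hE, hx, map_zero]
    have h2 : g.codRestrict _ hg x = 0 := Subtype.ext h1
    have h3 : p x = ⟨x, h1⟩ := LinearMap.congr_fun hp ⟨x, h1⟩
    simp only [E₁, LinearMap.add_apply, LinearMap.comp_apply, h2, h3, map_zero, zero_add,
      Submodule.subtype_apply, LinearEquiv.coe_coe, Submodule.coe_eq_zero,
      LinearEquiv.map_eq_zero_iff] at hx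
    exact congrArg Subtype.val hx
  exact ⟨LinearEquiv.ofInjectiveEndo E₁ hinj, fun x => by simpa using hE x⟩

theorem exists_compl_inf (U V : Submodule K E) :
    ∃ V₁ ≤ V, Disjoint U V₁ ∧ U ⊓ V ⊔ V₁ = V := by
  obtain ⟨C, hC⟩ := (U ⊓ V).exists_isCompl
  refine ⟨C ⊓ V, inf_le_right, ?_, ?_⟩
  · rw [disjoint_iff]
    have := hC.disjoint.eq_bot
    rw [← this]
    apply le_antisymm
    · exact le_inf (le_inf inf_le_left (inf_le_right.trans inf_le_right))
        (inf_le_right.trans inf_le_left)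
    · exact le_inf (inf_le_left.trans inf_le_left)
        (le_inf inf_le_right (inf_le_left.trans inf_le_right))
  · rw [sup_inf_assoc_of_le C (inf_le_right : U ⊓ V ≤ V) |>.symm, hC.sup_eq_top, top_inf_eq]

theorem finrank_sup_of_disjoint [FiniteDimensional K E] {U V : Submodule K E} (h : Disjoint U V) :
    finrank K (U ⊔ V : Submodule K E) = finrank K U + finrank K V := by
  have := Submodule.finrank_sup_add_finrank_inf_eq U V
  rw [h.eq_bot, finrank_bot] at this
  omega

/-- Pairs of subspaces with the same dimensions, also of the intersection, are equivalent
under an automorphism. -/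
theorem exists_linearEquiv_map_pair [FiniteDimensional K E] {U V U' V' : Submodule K E}
    (hU : finrank K U = finrank K U') (hV : finrank K V = finrank K V')
    (hI : finrank K (U ⊓ V : Submodule K E) = finrank K (U' ⊓ V' : Submodule K E)) :
    ∃ φ : E ≃ₗ[K] E, U.map φ.toLinearMap = U' ∧ V.map φ.toLinearMap = V' := by
  obtain ⟨V₁, hV₁, hd, hs⟩ := exists_compl_inf U V
  obtain ⟨V₁', hV₁', hd', hs'⟩ := exists_compl_inf U' V'
  have hdim : finrank K V₁ = finrank K V₁' := by
    have h1 := finrank_sup_of_disjoint (hd.mono_left (inf_le_left : U ⊓ V ≤ U))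
    have h2 := finrank_sup_of_disjoint (hd'.mono_left (inf_le_left : U' ⊓ V' ≤ U'))
    rw [hs] at h1
    rw [hs'] at h2
    omega
  let e₁ : V₁ ≃ₗ[K] V₁' := LinearEquiv.ofFinrankEq _ _ hdim
  let e₀ : (U ⊓ V : Submodule K E) ≃ₗ[K] (U' ⊓ V' : Submodule K E) := LinearEquiv.ofFinrankEq _ _ hI
  let eU : U ≃ₗ[K] U' := LinearEquiv.ofFinrankEq _ _ hU
  -- `eU` was chosen without regard to the intersections; `τ` corrects it so that `τ ∘ eU` restricts
  -- to `e₀` on `U ⊓ V`.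
  obtain ⟨τ, hτ⟩ := exists_linearEquiv_comp_eq_of_injective
    (f := eU.toLinearMap.comp (Submodule.inclusion (inf_le_left : U ⊓ V ≤ U)))
    (g := (Submodule.inclusion (inf_le_left : U' ⊓ V' ≤ U')).comp e₀.toLinearMap)
    (eU.injective.comp (Submodule.inclusion_injective _))
    ((Submodule.inclusion_injective (inf_le_left : U' ⊓ V' ≤ U')).comp e₀.injective)
  -- Since `V₁` meets `U` trivially and completes `U ⊓ V` to `V`, the product `U × V₁` parametrizes
  -- `U ⊔ V`; matching the two parametrizations defines `φ` there.
  let f : U × V₁ →ₗ[K] E := U.subtype.coprod V₁.subtype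
  let g : U × V₁ →ₗ[K] E := (U'.subtype.comp (eU ≪≫ₗ τ).toLinearMap).coprod
    (V₁'.subtype.comp e₁.toLinearMap)
  have hf : Function.Injective f := by
    rw [← LinearMap.ker_eq_bot, LinearMap.ker_coprod_of_disjoint_range]
    · simp
    · simpa using hd
  have hg : Function.Injective g := by
    rw [← LinearMap.ker_eq_bot, LinearMap.ker_coprod_of_disjoint_range]
    · rw [LinearMap.ker_eq_bot.2, LinearMap.ker_eq_bot.2, Submodule.prod_bot]
      · exact (Submodule.subtype_injective _).comp e₁.injective
      · exact (Submodule.subtype_injective _).comp (eU ≪≫ₗ τ).injective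
    · refine hd'.mono ?_ ?_
      · rintro _ ⟨x, rfl⟩
        exact ((eU ≪≫ₗ τ) x).2
      · rintro _ ⟨x, rfl⟩
        exact (e₁ x).2
  obtain ⟨φ, hφ⟩ := exists_linearEquiv_comp_eq_of_injective hf hg
  have hφU : ∀ x : U, φ x = τ (eU x) := fun x => by simpa [f, g] using hφ (x, 0)
  have hφV : ∀ x : V₁, φ x = e₁ x := fun x => by simpa [f, g] using hφ (0, x)
  refine ⟨φ, ?_, ?_⟩
  · apply Submodule.eq_of_le_of_finrank_eq
    · rintro _ ⟨x, hx, rfl⟩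
      have := hφU ⟨x, hx⟩
      simp only [LinearEquiv.coe_coe] at this ⊢
      rw [this]
      exact (τ (eU ⟨x, hx⟩)).2
    · rw [← hU]
      exact φ.finrank_map_eq U
  · apply Submodule.eq_of_le_of_finrank_eq
    · rw [← hs, Submodule.map_sup]
      refine sup_le ?_ ?_
      · rintro _ ⟨x, hx, rfl⟩
        have h1 := hφU ⟨x, hx.1⟩
        have h2 := hτ ⟨x, hx⟩
        simp only [LinearEquiv.coe_coe] at h1 ⊢
        rw [h1]
        have h3 := congrArg Subtype.val h2
        simp only [LinearMap.comp_apply, LinearEquiv.coe_coe, Submodule.coe_inclusion] at h3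
        have h4 : Submodule.inclusion (inf_le_left : U ⊓ V ≤ U) ⟨x, hx⟩ = ⟨x, hx.1⟩ := rfl
        rw [h4] at h3
        rw [h3]
        exact (e₀ ⟨x, hx⟩).2.2
      · rintro _ ⟨x, hx, rfl⟩
        have h1 := hφV ⟨x, hx⟩
        simp only [LinearEquiv.coe_coe] at h1 ⊢
        rw [h1]
        exact hV₁' (e₁ ⟨x, hx⟩).2
    · rw [← hV]
      exact φ.finrank_map_eq V

theorem exists_linearEquiv_map_eq [FiniteDimensional K E] {U U' : Submodule K E}
    (hU : finrank K U = finrank K U') : ∃ φ : E ≃ₗ[K] E, U.map φ.toLinearMap = U' := by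
  obtain ⟨φ, h, -⟩ := exists_linearEquiv_map_pair hU (V := ⊥) (V' := ⊥) rfl
    (by rw [inf_bot_eq, inf_bot_eq])
  exact ⟨φ, h⟩

theorem finrank_map_mkQ_add_finrank_inf [FiniteDimensional K E] (U V : Submodule K E) :
    finrank K (U.map V.mkQ) + finrank K (U ⊓ V : Submodule K E) = finrank K U := by
  have h := (V.mkQ.domRestrict U).finrank_range_add_finrank_ker
  rw [LinearMap.range_domRestrict, LinearMap.ker_domRestrict, Submodule.ker_mkQ] at h
  have h2 : V.comap U.subtype = (U ⊓ V).comap U.subtype := by ext; simp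
  rw [← h, h2, (Submodule.comapSubtypeEquivOfLe (inf_le_left : U ⊓ V ≤ U)).finrank_eq]

end LinearAlgebra

/-! ### The action of invertible matrices, and well-definedness of the counting functions. -/

section Counting

variable {F : Type*} [Field F] {n m : ℕ}

theorem rowSpace_eq_range (M : Matrix (Fin n) (Fin m) F) :
    rowSpace M = LinearMap.range M.vecMulLinear :=
  (range_vecMulLinear M).symm

theorem finrank_rowSpace (M : Matrix (Fin n) (Fin m) F) : finrank F (rowSpace M) = M.rank :=
  (Matrix.rank_eq_finrank_span_row M).symm

/-- The automorphism `M ↦ A * M * Q` of the space of matrices. -/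
def mulEquiv (A : GL (Fin n) F) (Q : GL (Fin m) F) :
    Matrix (Fin n) (Fin m) F ≃ Matrix (Fin n) (Fin m) F where
  toFun M := A.1 * M * Q.1
  invFun M := A⁻¹.1 * M * Q⁻¹.1
  left_inv M := by
    have h1 : A⁻¹.1 * A.1 = 1 := A.inv_mul
    have h2 : Q.1 * Q⁻¹.1 = 1 := Q.mul_inv
    calc A⁻¹.1 * (A.1 * M * Q.1) * Q⁻¹.1 = (A⁻¹.1 * A.1) * M * (Q.1 * Q⁻¹.1) := by
          simp only [Matrix.mul_assoc]
      _ = M := by rw [h1, h2, Matrix.one_mul, Matrix.mul_one]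
  right_inv M := by
    have h1 : A.1 * A⁻¹.1 = 1 := A.mul_inv
    have h2 : Q⁻¹.1 * Q.1 = 1 := Q.inv_mul
    calc A.1 * (A⁻¹.1 * M * Q⁻¹.1) * Q.1 = (A.1 * A⁻¹.1) * M * (Q⁻¹.1 * Q.1) := by
          simp only [Matrix.mul_assoc]
      _ = M := by rw [h1, h2, Matrix.one_mul, Matrix.mul_one]

theorem mulEquiv_apply (A : GL (Fin n) F) (Q : GL (Fin m) F) (M : Matrix (Fin n) (Fin m) F) :
    mulEquiv A Q M = A.1 * M * Q.1 := rfl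

theorem mulEquiv_one_right (A : GL (Fin n) F) (M : Matrix (Fin n) (Fin m) F) :
    mulEquiv A 1 M = A.1 * M := by
  rw [mulEquiv_apply, Units.val_one, Matrix.mul_one]

theorem mulEquiv_add (A : GL (Fin n) F) (Q : GL (Fin m) F) (M N : Matrix (Fin n) (Fin m) F) :
    mulEquiv A Q (M + N) = mulEquiv A Q M + mulEquiv A Q N := by
  simp only [mulEquiv_apply, Matrix.mul_add, Matrix.add_mul]

theorem rowSpace_mulEquiv (A : GL (Fin n) F) (Q : GL (Fin m) F) (M : Matrix (Fin n) (Fin m) F) :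
    rowSpace (mulEquiv A Q M) = (rowSpace M).map Q.1.vecMulLinear := by
  ext v
  simp only [rowSpace_eq_range, Submodule.mem_map, LinearMap.mem_range, Matrix.vecMulLinear_apply,
    mulEquiv_apply]
  constructor
  · rintro ⟨w, rfl⟩
    exact ⟨_, ⟨Matrix.vecMul w A.1, rfl⟩, by simp only [Matrix.vecMul_vecMul, Matrix.mul_assoc]⟩
  · rintro ⟨_, ⟨w, rfl⟩, rfl⟩
    refine ⟨Matrix.vecMul w A⁻¹.1, ?_⟩
    have h1 : A⁻¹.1 * A.1 = 1 := A.inv_mul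
    rw [Matrix.vecMul_vecMul, Matrix.vecMul_vecMul, Matrix.mul_assoc, ← Matrix.mul_assoc, h1,
      Matrix.one_mul]

theorem vecMulLinear_injective (Q : GL (Fin m) F) : Function.Injective Q.1.vecMulLinear := by
  apply Function.LeftInverse.injective (g := Q⁻¹.1.vecMulLinear)
  intro v
  have h1 : Q.1 * Q⁻¹.1 = 1 := Q.mul_inv
  simp only [Matrix.vecMulLinear_apply, Matrix.vecMul_vecMul, h1, Matrix.vecMul_one]

theorem rank_mulEquiv (A : GL (Fin n) F) (Q : GL (Fin m) F) (M : Matrix (Fin n) (Fin m) F) :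
    (mulEquiv A Q M).rank = M.rank := by
  rw [← finrank_rowSpace, rowSpace_mulEquiv,
    ← (Submodule.equivMapOfInjective _ (vecMulLinear_injective Q) (rowSpace M)).finrank_eq,
    finrank_rowSpace]

theorem exists_GL_of_linearEquiv (φ : (Fin m → F) ≃ₗ[F] (Fin m → F)) :
    ∃ Q : GL (Fin m) F, Q.1.vecMulLinear = φ.toLinearMap := by
  refine ⟨⟨(LinearMap.toMatrix' φ.toLinearMap).transpose,
    (LinearMap.toMatrix' φ.symm.toLinearMap).transpose, ?_, ?_⟩, ?_⟩
  · rw [← Matrix.transpose_mul, ← LinearMap.toMatrix'_comp]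
    simp
  · rw [← Matrix.transpose_mul, ← LinearMap.toMatrix'_comp]
    simp
  · refine LinearMap.ext fun v => ?_
    rw [Matrix.vecMulLinear_apply, Matrix.vecMul_transpose, LinearMap.toMatrix'_mulVec]

/-- As maps on row vectors, `M` and `N` have the same range, so they differ by an automorphism of
the source, which is a left multiplication. -/
theorem exists_mul_eq_of_rowSpace_eq {M N : Matrix (Fin n) (Fin m) F}
    (h : rowSpace M = rowSpace N) : ∃ A : GL (Fin n) F, A.1 * M = N := by
  rw [rowSpace_eq_range, rowSpace_eq_range] at h
  obtain ⟨e, he⟩ := exists_linearEquiv_comp_eq_of_range_eq h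
  obtain ⟨A, hA⟩ := exists_GL_of_linearEquiv e
  refine ⟨A, ?_⟩
  refine Matrix.ext_iff_vecMul.2 fun v => ?_
  have h1 : Matrix.vecMul v A.1 = e v := LinearMap.congr_fun hA v
  rw [← Matrix.vecMul_vecMul, h1]
  exact he v

theorem exists_mulEquiv_eq_of_rank_eq {M N : Matrix (Fin n) (Fin m) F}
    (h : M.rank = N.rank) : ∃ (A : GL (Fin n) F) (Q : GL (Fin m) F), mulEquiv A Q M = N := by
  rw [← finrank_rowSpace, ← finrank_rowSpace] at h
  obtain ⟨φ, hφ⟩ := exists_linearEquiv_map_eq h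
  obtain ⟨Q, hQ⟩ := exists_GL_of_linearEquiv φ
  have h1 : rowSpace (mulEquiv 1 Q M) = rowSpace N := by rw [rowSpace_mulEquiv, hQ, hφ]
  obtain ⟨A, hA⟩ := exists_mul_eq_of_rowSpace_eq h1
  refine ⟨A, Q, ?_⟩
  rw [← hA, mulEquiv_apply, mulEquiv_apply, Units.val_one, Matrix.one_mul, Matrix.mul_assoc]

theorem quotDim_add_finrank_inf (U V : Submodule F (Fin m → F)) :
    quotDim U V + finrank F (U ⊓ V : Submodule F (Fin m → F)) = finrank F U :=
  finrank_map_mkQ_add_finrank_inf U V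

theorem count0_map (U : Submodule F (Fin m → F)) (Q : GL (Fin m) F) :
    count0 F n m (U.map Q.1.vecMulLinear) = count0 F n m U := by
  refine (Nat.card_congr ((mulEquiv 1 Q).subtypeEquiv fun M => ?_)).symm
  rw [rowSpace_mulEquiv, (Submodule.map_injective_of_injective (vecMulLinear_injective Q)).eq_iff]

theorem count1_map (M : Matrix (Fin n) (Fin m) F) (V : Submodule F (Fin m → F)) (r : ℕ)
    (A : GL (Fin n) F) (Q : GL (Fin m) F) :
    count1 F n m (mulEquiv A Q M) (V.map Q.1.vecMulLinear) r = count1 F n m M V r := by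
  refine (Nat.card_congr ((mulEquiv A Q).subtypeEquiv fun B => ?_)).symm
  rw [← mulEquiv_add, rowSpace_mulEquiv, rank_mulEquiv,
    (Submodule.map_injective_of_injective (vecMulLinear_injective Q)).eq_iff]

theorem count2_map (X : Matrix (Fin n) (Fin m) F) (r rB : ℕ)
    (A : GL (Fin n) F) (Q : GL (Fin m) F) :
    count2 F n m (mulEquiv A Q X) r rB = count2 F n m X r rB := by
  refine (Nat.card_congr ((mulEquiv A Q).subtypeEquiv fun B => ?_)).symm
  rw [← mulEquiv_add, rank_mulEquiv, rank_mulEquiv]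

variable [Fintype F]

theorem count0_eq_f0 {u : ℕ} {U : Submodule F (Fin m → F)} (hU : finrank F U = u) :
    count0 F n m U = f0 F n m u := by
  have hex : ∃ U : Submodule F (Fin m → F), finrank F U = u := ⟨U, hU⟩
  rw [f0, dif_pos hex]
  obtain ⟨φ, hφ⟩ := exists_linearEquiv_map_eq (hU.trans hex.choose_spec.symm)
  obtain ⟨Q, hQ⟩ := exists_GL_of_linearEquiv φ
  rw [← hφ, ← hQ, count0_map]

/-- The condition on `quotDim` fixes the dimension of the intersection, so a right multiplication
carries the pair (row space, `V`) to the chosen one. A left multiplication, which preserves row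
spaces, then carries the matrix itself to the chosen one. -/
theorem count1_eq_f1 {u v h : ℕ} (r : ℕ) {M : Matrix (Fin n) (Fin m) F}
    {V : Submodule F (Fin m → F)} (hM : finrank F (rowSpace M) = u) (hV : finrank F V = v)
    (hMV : quotDim (rowSpace M) V = h) :
    count1 F n m M V r = f1 F n m u v h r := by
  have hex : ∃ p : Matrix (Fin n) (Fin m) F × Submodule F (Fin m → F),
      finrank F (rowSpace p.1) = u ∧ finrank F p.2 = v ∧ quotDim (rowSpace p.1) p.2 = h :=
    ⟨(M, V), hM, hV, hMV⟩
  rw [f1, dif_pos hex]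
  obtain ⟨h1, h2, h3⟩ := hex.choose_spec
  have h4 := quotDim_add_finrank_inf (rowSpace M) V
  have h5 := quotDim_add_finrank_inf (rowSpace hex.choose.1) hex.choose.2
  obtain ⟨φ, hφ, hφ'⟩ := exists_linearEquiv_map_pair (hM.trans h1.symm) (hV.trans h2.symm)
    (by omega)
  obtain ⟨Q, hQ⟩ := exists_GL_of_linearEquiv φ
  obtain ⟨A, hA⟩ := exists_mul_eq_of_rowSpace_eq (M := mulEquiv 1 Q M) (N := hex.choose.1)
    (by rw [rowSpace_mulEquiv, hQ, hφ])
  have hAQ : mulEquiv A Q M = hex.choose.1 := by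
    rw [← hA, mulEquiv_apply, mulEquiv_apply, Units.val_one, Matrix.one_mul, Matrix.mul_assoc]
  rw [← hAQ, ← hφ', ← hQ, count1_map]

theorem count2_eq_f2 (r : ℕ) {rX : ℕ} (rB : ℕ) {X : Matrix (Fin n) (Fin m) F} (hX : X.rank = rX) :
    count2 F n m X r rB = f2 F n m r rX rB := by
  have hex : ∃ X : Matrix (Fin n) (Fin m) F, X.rank = rX := ⟨X, hX⟩
  rw [f2, dif_pos hex]
  obtain ⟨A, Q, hAQ⟩ := exists_mulEquiv_eq_of_rank_eq (hX.trans hex.choose_spec.symm)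
  rw [← hAQ, count2_map]

end Counting

/-! ### Counting subspaces by dimension and position relative to a fixed subspace. -/

section Subspaces

variable {K E : Type*} [Field K] [AddCommGroup E] [Module K E]

/-- The splitting of a space as a subspace and the quotient by it, compatible with the
quotient map. -/
theorem exists_equiv_quotient_prod (U : Submodule K E) :
    ∃ e : E ≃ (E ⧸ U) × U, ∀ x, (e x).1 = U.mkQ x := by
  obtain ⟨s, hs⟩ := LinearMap.exists_rightInverse_of_surjective U.mkQ U.range_mkQ
  have hs' : ∀ x, U.mkQ (s x) = x := LinearMap.congr_fun hs
  have hmem : ∀ x, x - s (U.mkQ x) ∈ U := fun x => by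
    have h : x - s (U.mkQ x) ∈ LinearMap.ker U.mkQ := by
      rw [LinearMap.mem_ker, map_sub, hs', sub_self]
    rwa [U.ker_mkQ] at h
  refine ⟨⟨fun x => (U.mkQ x, ⟨x - s (U.mkQ x), hmem x⟩), fun p => s p.1 + p.2, ?_, ?_⟩,
    fun x => rfl⟩
  · intro x
    simp
  · rintro ⟨x, y⟩
    have h1 : U.mkQ (s x + y) = x := by
      rw [map_add, hs', Submodule.mkQ_apply,
        (Submodule.Quotient.mk_eq_zero U).2 y.2, add_zero]
    refine Prod.ext h1 (Subtype.ext ?_)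
    change s x + y - s (U.mkQ (s x + y)) = y
    rw [h1, add_sub_cancel_left]

/-- Independence modulo `U` constrains only the quotient component of each vector; its component in
`U` is free. -/
theorem card_linearIndependent_mkQ [Fintype K] [Finite E] (U : Submodule K E) (k : ℕ) :
    Nat.card {c : Fin k → E // LinearIndependent K (U.mkQ ∘ c)} =
      Nat.card {s : Fin k → E ⧸ U // LinearIndependent K s} * Nat.card U ^ k := by
  obtain ⟨e, he⟩ := exists_equiv_quotient_prod U
  let e₁ : (Fin k → E) ≃ (Fin k → E ⧸ U) × (Fin k → U) :=
    (Equiv.arrowCongr (Equiv.refl _) e).trans (Equiv.arrowProdEquivProdArrow _ _ _)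
  have h : {c : Fin k → E // LinearIndependent K (U.mkQ ∘ c)} ≃
      {s : Fin k → E ⧸ U // LinearIndependent K s} × (Fin k → U) :=
    (e₁.subtypeEquiv (q := fun p => LinearIndependent K p.1 ∧ True) fun c => by
      rw [and_true]
      have : (e₁ c).1 = U.mkQ ∘ c := funext fun i => he (c i)
      rw [this]).trans
    ((Equiv.subtypeProdEquivProd (p := fun s : Fin k → E ⧸ U => LinearIndependent K s)
      (q := fun _ : Fin k → U => True)).trans
        ((Equiv.refl _).prodCongr (Equiv.subtypeUnivEquiv fun _ => trivial)))
  rw [Nat.card_congr h, Nat.card_prod, Nat.card_fun, Nat.card_fin]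

/-- A family `a` of linearly independent vectors of `U`, and a family `c` of vectors that are
linearly independent modulo `U`. -/
def Adapted (U : Submodule K E) {d k : ℕ} (p : (Fin d → E) × (Fin k → E)) : Prop :=
  (∀ i, p.1 i ∈ U) ∧ LinearIndependent K p.1 ∧ LinearIndependent K (U.mkQ ∘ p.2)

theorem card_adapted [Fintype K] [Finite E] (U : Submodule K E) {d k : ℕ}
    (hd : d ≤ finrank K U) (hk : k ≤ finrank K (E ⧸ U)) :
    Nat.card {p : (Fin d → E) × (Fin k → E) // Adapted U p} =
      (∏ i : Fin d, (Fintype.card K ^ finrank K U - Fintype.card K ^ i.val)) *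
      ((∏ i : Fin k, (Fintype.card K ^ finrank K (E ⧸ U) - Fintype.card K ^ i.val)) *
        (Fintype.card K ^ finrank K U) ^ k) := by
  have h1 : {p : (Fin d → E) × (Fin k → E) // Adapted U p} ≃
      {a : Fin d → U // LinearIndependent K a} ×
        {c : Fin k → E // LinearIndependent K (U.mkQ ∘ c)} :=
    { toFun := fun p => (⟨fun i => ⟨p.1.1 i, p.2.1 i⟩, LinearIndependent.of_comp U.subtype p.2.2.1⟩,
        ⟨p.1.2, p.2.2.2⟩)
      invFun := fun p => ⟨(fun i => p.1.1 i, p.2.1), fun i => (p.1.1 i).2,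
        p.1.2.map' U.subtype U.ker_subtype, p.2.2⟩
      left_inv := fun p => rfl
      right_inv := fun p => rfl }
  have : Finite (E ⧸ U) := Finite.of_surjective _ U.mkQ_surjective
  rw [Nat.card_congr h1, Nat.card_prod, card_linearIndependent_mkQ, card_linearIndependent hd,
    card_linearIndependent hk, Module.natCard_eq_pow_finrank (K := K) (V := U),
    Nat.card_eq_fintype_card]

theorem finrank_quotient_comap_subtype [FiniteDimensional K E] (U V : Submodule K E) {d k : ℕ}
    (hV : finrank K V = d + k) (hI : finrank K (U ⊓ V : Submodule K E) = d) :
    finrank K (U.comap V.subtype) = d ∧ finrank K (V ⧸ U.comap V.subtype) = k := by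
  have h1 : U.comap V.subtype = (U ⊓ V).comap V.subtype := by ext; simp
  have h2 : finrank K (U.comap V.subtype) = d := by
    rw [h1, (Submodule.comapSubtypeEquivOfLe (inf_le_right : U ⊓ V ≤ V)).finrank_eq, hI]
  have h3 := (U.comap V.subtype).finrank_quotient_add_finrank
  exact ⟨h2, by omega⟩

theorem adapted_comap_subtype_iff (U V : Submodule K E) {d k : ℕ}
    (p : (Fin d → V) × (Fin k → V)) :
    Adapted (U.comap V.subtype) p ↔
      Adapted U ((fun i => (p.1 i : E)), (fun i => (p.2 i : E))) := by
  have h1 : LinearIndependent K (fun i => (p.1 i : E)) ↔ LinearIndependent K p.1 :=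
    V.subtype.linearIndependent_iff V.ker_subtype
  let f : (V ⧸ U.comap V.subtype) →ₗ[K] E ⧸ U := (U.comap V.subtype).mapQ U V.subtype le_rfl
  have hf : LinearMap.ker f = ⊥ := by
    rw [Submodule.ker_mapQ, Submodule.mkQ_map_self]
  have h2 : LinearIndependent K (U.mkQ ∘ (fun i => (p.2 i : E))) ↔
      LinearIndependent K ((U.comap V.subtype).mkQ ∘ p.2) :=
    f.linearIndependent_iff hf (v := (U.comap V.subtype).mkQ ∘ p.2)
  simp only [Adapted, h1, h2, Submodule.mem_comap, Submodule.subtype_apply]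

/-- Adapted families inside `V` are those of the ambient space `V` relative to the trace of `U` on
it, because `V / (U ∩ V)` embeds in `E / U`. -/
theorem card_adapted_mem [Fintype K] [Finite E] (U V : Submodule K E) {d k : ℕ}
    (hV : finrank K V = d + k) (hI : finrank K (U ⊓ V : Submodule K E) = d) :
    Nat.card {p : (Fin d → E) × (Fin k → E) //
        Adapted U p ∧ (∀ i, p.1 i ∈ V) ∧ (∀ i, p.2 i ∈ V)} =
      (∏ i : Fin d, (Fintype.card K ^ d - Fintype.card K ^ i.val)) *
      ((∏ i : Fin k, (Fintype.card K ^ k - Fintype.card K ^ i.val)) *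
        (Fintype.card K ^ d) ^ k) := by
  obtain ⟨h1, h2⟩ := finrank_quotient_comap_subtype U V hV hI
  have h3 := card_adapted (U.comap V.subtype) h1.ge h2.ge
  rw [h1, h2] at h3
  rw [← h3]
  exact Nat.card_congr
    { toFun := fun p => ⟨(fun i => ⟨p.1.1 i, p.2.2.1 i⟩, fun i => ⟨p.1.2 i, p.2.2.2 i⟩),
        (adapted_comap_subtype_iff U V _).2 p.2.1⟩
      invFun := fun p => ⟨(fun i => (p.1.1 i : E), fun i => (p.1.2 i : E)),
        (adapted_comap_subtype_iff U V _).1 p.2, fun i => (p.1.1 i).2, fun i => (p.1.2 i).2⟩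
      left_inv := fun p => rfl
      right_inv := fun p => rfl }

/-- The subspace is the span of both families. It has dimension at most `d + k`, its intersection
with `U` at least `d` and its image modulo `U` at least `k`, so all three bounds are equalities. -/
theorem Adapted.existsUnique_submodule [FiniteDimensional K E] {U : Submodule K E} {d k : ℕ}
    {p : (Fin d → E) × (Fin k → E)} (hp : Adapted U p) :
    ∃! V : Submodule K E, (finrank K V = d + k ∧ finrank K (U ⊓ V : Submodule K E) = d) ∧
      (∀ i, p.1 i ∈ V) ∧ (∀ i, p.2 i ∈ V) := by
  obtain ⟨hU, ha, hc⟩ := hp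
  let V : Submodule K E := Submodule.span K (Set.range (Sum.elim p.1 p.2))
  have hVa : ∀ i, p.1 i ∈ V := fun i => Submodule.subset_span ⟨Sum.inl i, rfl⟩
  have hVc : ∀ i, p.2 i ∈ V := fun i => Submodule.subset_span ⟨Sum.inr i, rfl⟩
  have h1 : finrank K V ≤ d + k := by
    have := finrank_range_le_card (R := K) (Sum.elim p.1 p.2)
    simpa [Set.finrank] using this
  have h2 : d ≤ finrank K (U ⊓ V : Submodule K E) := by
    have h3 := finrank_span_eq_card ha
    rw [Fintype.card_fin] at h3
    rw [← h3]
    apply Submodule.finrank_mono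
    rw [Submodule.span_le]
    rintro _ ⟨i, rfl⟩
    exact ⟨hU i, hVa i⟩
  have h4 : k ≤ finrank K (V.map U.mkQ) := by
    have h3 := finrank_span_eq_card hc
    rw [Fintype.card_fin] at h3
    rw [← h3]
    apply Submodule.finrank_mono
    rw [Submodule.span_le]
    rintro _ ⟨i, rfl⟩
    exact ⟨_, hVc i, rfl⟩
  have h5 := finrank_map_mkQ_add_finrank_inf V U
  rw [inf_comm] at h5
  refine ⟨V, ⟨⟨by omega, by omega⟩, hVa, hVc⟩, ?_⟩
  rintro V' ⟨⟨h6, -⟩, h7, h8⟩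
  refine (Submodule.eq_of_le_of_finrank_eq ?_ ?_).symm
  · rw [Submodule.span_le]
    rintro _ ⟨i | i, rfl⟩
    · exact h7 i
    · exact h8 i
  · omega

/-- Double counting: each adapted pair of families belongs to exactly one such subspace, and every
subspace carries the same number of them. -/
theorem card_submodule_mul [Fintype K] [Finite E] (U : Submodule K E) {d k : ℕ}
    (hd : d ≤ finrank K U) (hk : k ≤ finrank K (E ⧸ U)) :
    Nat.card {V : Submodule K E // finrank K V = d + k ∧
        finrank K (U ⊓ V : Submodule K E) = d} *
      ((∏ i : Fin d, (Fintype.card K ^ d - Fintype.card K ^ i.val)) *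
      ((∏ i : Fin k, (Fintype.card K ^ k - Fintype.card K ^ i.val)) *
        (Fintype.card K ^ d) ^ k)) =
      (∏ i : Fin d, (Fintype.card K ^ finrank K U - Fintype.card K ^ i.val)) *
      ((∏ i : Fin k, (Fintype.card K ^ finrank K (E ⧸ U) - Fintype.card K ^ i.val)) *
        (Fintype.card K ^ finrank K U) ^ k) := by
  rw [← card_adapted U hd hk]
  have e : {p : (Fin d → E) × (Fin k → E) // Adapted U p} ≃
      Σ V : {V : Submodule K E // finrank K V = d + k ∧ finrank K (U ⊓ V : Submodule K E) = d},
        {p : (Fin d → E) × (Fin k → E) //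
          Adapted U p ∧ (∀ i, p.1 i ∈ V.1) ∧ (∀ i, p.2 i ∈ V.1)} := by
    refine (Equiv.ofBijective (fun x => ⟨x.2.1, x.2.2.1⟩) ⟨?_, ?_⟩).symm
    · rintro ⟨⟨V, hV⟩, p, hp⟩ ⟨⟨V', hV'⟩, p', hp'⟩ h
      obtain rfl : p = p' := congrArg Subtype.val h
      obtain rfl : V = V' := hp.1.existsUnique_submodule.unique ⟨hV, hp.2⟩ ⟨hV', hp'.2⟩
      rfl
    · rintro ⟨p, hp⟩
      obtain ⟨V, hV, -⟩ := hp.existsUnique_submodule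
      exact ⟨⟨⟨V, hV.1⟩, p, hp, hV.2⟩, rfl⟩
  have : Finite (Submodule K E) := Finite.of_injective _ SetLike.coe_injective
  have : Fintype {V : Submodule K E // finrank K V = d + k ∧
        finrank K (U ⊓ V : Submodule K E) = d} := Fintype.ofFinite _
  rw [Nat.card_congr e, Nat.card_sigma,
    Finset.sum_congr rfl fun V _ => card_adapted_mem U V.1 V.2.1 V.2.2, Finset.sum_const,
    Finset.card_univ, Nat.card_eq_fintype_card, smul_eq_mul]

theorem cast_prod_pow_sub_pow {q a d : ℕ} (hq : 1 ≤ q) (h : d ≤ a) :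
    ((∏ i : Fin d, (q ^ a - q ^ i.val) : ℕ) : ℝ) =
      ∏ i ∈ Finset.range d, ((q : ℝ) ^ a - (q : ℝ) ^ i) := by
  rw [Finset.prod_range, Nat.cast_prod]
  refine Finset.prod_congr rfl fun i _ => ?_
  rw [Nat.cast_sub (Nat.pow_le_pow_right hq (by omega))]
  push_cast
  rfl

theorem gaussBinom_natCast (q : ℝ) {a d : ℕ} (h : d ≤ a) :
    gaussBinom q a d = (∏ i ∈ Finset.range d, (q ^ a - q ^ i)) /
      ∏ i ∈ Finset.range d, (q ^ d - q ^ i) := by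
  rw [gaussBinom, if_pos ⟨by positivity, by exact_mod_cast h⟩, Int.toNat_natCast,
    Finset.prod_div_distrib]

theorem card_submodule_eq_gaussBinom [Fintype K] [Finite E] (U : Submodule K E) {d k : ℕ}
    (hd : d ≤ finrank K U) (hk : k ≤ finrank K (E ⧸ U)) :
    (Nat.card {V : Submodule K E // finrank K V = d + k ∧
        finrank K (U ⊓ V : Submodule K E) = d} : ℝ) =
      (Fintype.card K : ℝ) ^ (k * (finrank K U - d)) *
        gaussBinom (Fintype.card K) (finrank K (E ⧸ U)) k *
        gaussBinom (Fintype.card K) (finrank K U) d := by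
  have hq : 1 < Fintype.card K := Fintype.one_lt_card
  have hq' : (1 : ℝ) < Fintype.card K := by exact_mod_cast hq
  have h := congrArg (Nat.cast (R := ℝ)) (card_submodule_mul U hd hk)
  have hpos : ∀ j : ℕ, (∏ i ∈ Finset.range j,
      ((Fintype.card K : ℝ) ^ j - (Fintype.card K : ℝ) ^ i)) ≠ 0 := fun j =>
    Finset.prod_ne_zero_iff.2 fun i hi =>
      (sub_pos.2 (pow_lt_pow_right₀ hq' (Finset.mem_range.1 hi))).ne'
  have h1 := hpos d
  have h2 := hpos k
  rw [Nat.cast_mul, Nat.cast_mul, Nat.cast_mul, Nat.cast_mul, Nat.cast_mul,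
    cast_prod_pow_sub_pow hq.le le_rfl, cast_prod_pow_sub_pow hq.le le_rfl,
    cast_prod_pow_sub_pow hq.le hd, cast_prod_pow_sub_pow hq.le hk] at h
  push_cast at h
  -- The quotient of the free `U`-components in the whole space by those inside one subspace is the
  -- power of `q` in the formula.
  have h3 : ((Fintype.card K : ℝ) ^ finrank K U) ^ k =
      (Fintype.card K : ℝ) ^ (k * (finrank K U - d)) * ((Fintype.card K : ℝ) ^ d) ^ k := by
    rw [← pow_mul, ← pow_mul, ← pow_add]
    congr 1
    obtain ⟨t, ht⟩ := Nat.exists_eq_add_of_le hd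
    rw [ht, Nat.add_sub_cancel_left]
    ring
  rw [h3] at h
  have h4 : ((Fintype.card K : ℝ) ^ d) ^ k ≠ 0 := by positivity
  rw [gaussBinom_natCast _ hd, gaussBinom_natCast _ hk, mul_div_assoc', mul_div_assoc', eq_div_iff h1,
    ← mul_left_inj' h2, div_mul_eq_mul_div, div_mul_cancel₀ _ h2]
  apply mul_right_cancel₀ h4
  linear_combination h

/-- The number of subspaces of dimension `u` whose sum with a subspace `U` of dimension `r`
exceeds them by `h` dimensions. -/
theorem card_submodule_quotDim {F : Type*} [Field F] [Fintype F] {m : ℕ}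
    {U : Submodule F (Fin m → F)} {r : ℕ} (hU : finrank F U = r) (u : ℕ) {h : ℕ} (hh : h ≤ r) :
    (Nat.card {V : Submodule F (Fin m → F) // finrank F V = u ∧ quotDim U V = h} : ℝ) =
      (Fintype.card F : ℝ) ^ (((u : ℤ) - r + h) * h) *
          gaussBinom (Fintype.card F) (m - r) ((u : ℤ) - r + h) *
          gaussBinom (Fintype.card F) r ((r : ℤ) - h) := by
  have hQ : finrank F ((Fin m → F) ⧸ U) = m - r := by
    have := U.finrank_quotient_add_finrank
    rw [finrank_fin_fun, hU] at this
    omega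
  have key : ∀ V : Submodule F (Fin m → F), (finrank F V = u ∧ quotDim U V = h) ↔
      (finrank F V = u ∧ finrank F (U ⊓ V : Submodule F (Fin m → F)) = r - h) := fun V => by
    have := quotDim_add_finrank_inf U V
    constructor <;> rintro ⟨h1, h2⟩ <;> refine ⟨h1, ?_⟩ <;> omega
  rw [Nat.card_congr (Equiv.subtypeEquivRight key)]
  -- The number `u - r + h` is the dimension of the image of `V` in the quotient by `U`. Outside `0,
  -- …, m - r` there is no such `V`, and the Gaussian binomial is `0` by convention.
  by_cases hk : 0 ≤ (u : ℤ) - r + h ∧ (u : ℤ) - r + h ≤ (m - r : ℕ)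
  · obtain ⟨k, hk'⟩ := Int.eq_ofNat_of_zero_le hk.1
    have hu : u = r - h + k := by omega
    have h1 := card_submodule_eq_gaussBinom U (d := r - h) (k := k) (by omega) (by omega)
    rw [hQ, hU, Nat.sub_sub_self hh] at h1
    rw [hk', hu, h1]
    rw [← zpow_natCast, Nat.cast_sub hh, Nat.cast_mul]
  · have h0 : gaussBinom (Fintype.card F) (m - r) ((u : ℤ) - r + h) = 0 := by
      rw [gaussBinom, if_neg hk]
    rw [h0, mul_zero, zero_mul, Nat.cast_eq_zero, Nat.card_eq_zero]
    left
    refine ⟨?_⟩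
    rintro ⟨V, hV, hI⟩
    have h1 := finrank_map_mkQ_add_finrank_inf V U
    have h2 := (V.map U.mkQ).finrank_le
    rw [inf_comm] at h1
    omega

end Subspaces

/-! ### Symmetry of the channel and the laws of the rank and the row space of the output. -/

section Channel

theorem natCard_subtype_eq_sum {α : Type*} [Fintype α] (p : α → Prop) [DecidablePred p] :
    (Nat.card {x // p x} : ℝ) = ∑ x, if p x then 1 else 0 := by
  rw [Nat.card_eq_fintype_card, Fintype.card_subtype, Finset.sum_boole]

theorem sum_mul_comp_eq_sum_fiber {α ι : Type*} [Fintype α] [Fintype ι] [DecidableEq ι]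
    (k : α → ι) (g : ι → ℝ) (ψ : α → ℝ) :
    ∑ x, g (k x) * ψ x = ∑ i, g i * ∑ x, if k x = i then ψ x else 0 := by
  simp_rw [Finset.mul_sum]
  rw [Finset.sum_comm]
  refine Finset.sum_congr rfl fun x _ => ?_
  simp

variable {F : Type*} [Field F] {n m : ℕ}

/-- The rank of a matrix, as an index of rank distributions. -/
def rankFin (M : Matrix (Fin n) (Fin m) F) : Fin (min n m + 1) := ⟨M.rank, rank_lt M⟩

theorem rankFin_eq_iff (M : Matrix (Fin n) (Fin m) F) (r : Fin (min n m + 1)) :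
    rankFin M = r ↔ M.rank = r := Fin.ext_iff

theorem rowSpace_mul (A : GL (Fin n) F) (M : Matrix (Fin n) (Fin m) F) :
    rowSpace (A.1 * M) = rowSpace M := by
  rw [← mulEquiv_one_right, rowSpace_mulEquiv]
  have h : (1 : GL (Fin m) F).1.vecMulLinear = LinearMap.id :=
    LinearMap.ext fun v => Matrix.vecMul_one v
  rw [h, Submodule.map_id]

/-- The first `r` unit vectors, padded with zero rows. This makes every rank class nonempty, so that
division by `numRank` is harmless. -/
theorem exists_rank_eq {r : ℕ} (h : r ≤ min n m) : ∃ M : Matrix (Fin n) (Fin m) F, M.rank = r := by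
  have hm : r ≤ m := h.trans (min_le_right _ _)
  have hn : r ≤ n := h.trans (min_le_left _ _)
  let v : Fin r → (Fin m → F) := fun i => Pi.single (Fin.castLE hm i) 1
  have hv : LinearIndependent F v := by
    have h := (Pi.basisFun F (Fin m)).linearIndependent.comp _ (Fin.castLE_injective hm)
    have hv' : v = Pi.basisFun F (Fin m) ∘ Fin.castLE hm :=
      funext fun i => (Pi.basisFun_apply F (Fin m) (Fin.castLE hm i)).symm
    rwa [hv']
  let M : Matrix (Fin n) (Fin m) F := fun i => if hi : i.1 < r then v ⟨i.1, hi⟩ else 0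
  refine ⟨M, ?_⟩
  have h1 : rowSpace M = Submodule.span F (Set.range v) := by
    apply le_antisymm
    · rw [rowSpace, Submodule.span_le]
      rintro _ ⟨i, rfl⟩
      by_cases hi : i.1 < r
      · have : M.row i = v ⟨i.1, hi⟩ := dif_pos hi
        rw [this]
        exact Submodule.subset_span ⟨_, rfl⟩
      · have : M.row i = 0 := dif_neg hi
        rw [this]
        exact Submodule.zero_mem _
    · rw [Submodule.span_le]
      rintro _ ⟨i, rfl⟩
      refine Submodule.subset_span ⟨Fin.castLE hn i, ?_⟩
      exact dif_pos (show (Fin.castLE hn i).1 < r from i.2)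
  rw [← finrank_rowSpace, h1, finrank_span_eq_card hv, Fintype.card_fin]

variable {R : Fin (min n m + 1) → ℝ}

theorem ugr_nonneg (hR : ∀ r, 0 ≤ R r) (M : Matrix (Fin n) (Fin m) F) : 0 ≤ ugr R M :=
  div_nonneg (hR _) (Nat.cast_nonneg _)

theorem ugr_mulEquiv (A : GL (Fin n) F) (Q : GL (Fin m) F) (M : Matrix (Fin n) (Fin m) F) :
    ugr R (mulEquiv A Q M) = ugr R M := by
  simp only [ugr, rank_mulEquiv]

variable [Fintype F]

theorem numRank_pos (r : Fin (min n m + 1)) : 0 < numRank F n m r := by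
  obtain ⟨M, hM⟩ := exists_rank_eq (F := F) (Nat.lt_succ_iff.1 r.2)
  have : Nonempty {M : Matrix (Fin n) (Fin m) F // M.rank = r} := ⟨⟨M, hM⟩⟩
  exact Nat.card_pos

theorem sum_ugr_ite (p : Matrix (Fin n) (Fin m) F → Prop) [DecidablePred p] :
    ∑ M, ugr R M * (if p M then 1 else 0) =
      ∑ r, R r * ((Nat.card {M : Matrix (Fin n) (Fin m) F // M.rank = r ∧ p M} : ℝ) /
        numRank F n m r) := by
  have h := sum_mul_comp_eq_sum_fiber (rankFin : Matrix (Fin n) (Fin m) F → _)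
    (fun r => R r / numRank F n m r) (fun M => if p M then 1 else 0)
  refine h.trans (Finset.sum_congr rfl fun r _ => ?_)
  rw [natCard_subtype_eq_sum, div_mul_eq_mul_div, mul_div_assoc]
  simp only [rankFin_eq_iff, ite_and]

/-- The distribution of the rank of a matrix with distribution `P`. -/
def rankDist (P : Matrix (Fin n) (Fin m) F → ℝ) (r : Fin (min n m + 1)) : ℝ :=
  ∑ X, if rankFin X = r then P X else 0

theorem sum_mul_comp_rankFin (P : Matrix (Fin n) (Fin m) F → ℝ) (g : Fin (min n m + 1) → ℝ) :
    ∑ X, P X * g (rankFin X) = ∑ r, rankDist P r * g r := by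
  simp_rw [mul_comm _ (g _)]
  exact sum_mul_comp_eq_sum_fiber _ _ _

theorem rankDist_mem {P : Matrix (Fin n) (Fin m) F → ℝ} (hP : P ∈ stdSimplex ℝ _) :
    rankDist P ∈ rankDists n m := by
  constructor
  · intro r
    refine Finset.sum_nonneg fun X _ => ?_
    split_ifs
    · exact hP.1 X
    · exact le_rfl
  · have := sum_mul_comp_rankFin P 1
    simp only [Pi.one_apply, mul_one] at this
    rw [← this]
    exact hP.2

theorem rankDist_ugr (R : Fin (min n m + 1) → ℝ) :
    rankDist (F := F) (ugr R) = R := by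
  funext r
  have hr : (numRank F n m r : ℝ) ≠ 0 := Nat.cast_ne_zero.2 (numRank_pos r).ne'
  have h : ∀ X : Matrix (Fin n) (Fin m) F, (if rankFin X = r then ugr R X else 0) =
      R r / numRank F n m r * (if X.rank = r then 1 else 0) := by
    intro X
    by_cases hX : X.rank = r
    · have hX' : rankFin X = r := (rankFin_eq_iff X r).2 hX
      have : ugr R X = R (rankFin X) / numRank F n m X.rank := rfl
      rw [if_pos hX', if_pos hX, mul_one, this, hX', hX]
    · rw [if_neg (fun h => hX ((rankFin_eq_iff X r).1 h)), if_neg hX, mul_zero]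
  simp only [rankDist, h]
  rw [← Finset.mul_sum, ← natCard_subtype_eq_sum]
  exact div_mul_cancel₀ _ hr

theorem ugr_mem (hR : R ∈ rankDists n m) : ugr (F := F) R ∈ stdSimplex ℝ _ := by
  refine ⟨ugr_nonneg hR.1, ?_⟩
  have := sum_mul_comp_rankFin (F := F) (ugr R) 1
  simp only [Pi.one_apply, mul_one, rankDist_ugr] at this
  rw [this]
  exact hR.2

variable [DecidableEq F]

theorem channelLaw_nonneg (hR : ∀ r, 0 ≤ R r) (X Y : Matrix (Fin n) (Fin m) F) :
    0 ≤ channelLaw R X Y := by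
  refine Finset.sum_nonneg fun A _ => Finset.sum_nonneg fun B _ => ?_
  have := ugr_nonneg hR B
  split_ifs <;> positivity

/-- Substitute `G ↦ A' * G * A⁻¹` in the sum over the group and `B ↦ A * B * Q` in the sum over the
noise; both noise laws are invariant. -/
theorem channelLaw_mulEquiv (A A' : GL (Fin n) F) (Q : GL (Fin m) F)
    (X Y : Matrix (Fin n) (Fin m) F) :
    channelLaw R (mulEquiv A Q X) (mulEquiv A' Q Y) = channelLaw R X Y := by
  unfold channelLaw
  rw [← Equiv.sum_comp ((Equiv.mulRight A⁻¹).trans (Equiv.mulLeft A'))]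
  refine Finset.sum_congr rfl fun G _ => ?_
  rw [← Equiv.sum_comp (mulEquiv A Q)]
  refine Finset.sum_congr rfl fun B _ => ?_
  rw [ugr_mulEquiv, ← mulEquiv_add]
  congr 1
  have h1 : (((Equiv.mulRight A⁻¹).trans (Equiv.mulLeft A') G : GL (Fin n) F) :
      Matrix (Fin n) (Fin n) F) * mulEquiv A Q (X + B) = mulEquiv A' Q (G.1 * (X + B)) := by
    have h2 : A⁻¹.1 * A.1 = 1 := A.inv_mul
    simp only [Equiv.trans_apply, Equiv.coe_mulRight, Equiv.coe_mulLeft, Units.val_mul,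
      mulEquiv_apply]
    calc A'.1 * (G.1 * A⁻¹.1) * (A.1 * (X + B) * Q.1) =
        A'.1 * G.1 * (A⁻¹.1 * A.1) * (X + B) * Q.1 := by simp only [Matrix.mul_assoc]
      _ = _ := by rw [h2, Matrix.mul_one]; simp only [Matrix.mul_assoc]
  simp only [h1, (mulEquiv A' Q).apply_eq_iff_eq]

/-- A function that is invariant under left multiplication does not see the random invertible
factor, so only the additive noise remains. -/
theorem sum_channelLaw_mul (X : Matrix (Fin n) (Fin m) F) {φ : Matrix (Fin n) (Fin m) F → ℝ}
    (hφ : ∀ (A : GL (Fin n) F) M, φ (A.1 * M) = φ M) :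
    ∑ Y, channelLaw R X Y * φ Y = ∑ B, ugr R B * φ (X + B) := by
  unfold channelLaw
  simp_rw [Finset.sum_mul]
  rw [Finset.sum_comm]
  have h1 : ∀ A : GL (Fin n) F, ∑ Y, ∑ B, (1 / (Fintype.card (GL (Fin n) F) : ℝ)) * ugr R B *
      (if A.1 * (X + B) = Y then 1 else 0) * φ Y =
      (1 / (Fintype.card (GL (Fin n) F) : ℝ)) * ∑ B, ugr R B * φ (X + B) := by
    intro A
    rw [Finset.sum_comm, Finset.mul_sum]
    refine Finset.sum_congr rfl fun B _ => ?_
    simp only [mul_ite, mul_one, mul_zero, ite_mul, zero_mul, Finset.sum_ite_eq, Finset.mem_univ,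
      if_true, hφ, mul_assoc]
  have hc : (Fintype.card (GL (Fin n) F) : ℝ) ≠ 0 := Nat.cast_ne_zero.2 Fintype.card_ne_zero
  rw [Finset.sum_congr rfl fun A _ => h1 A, Finset.sum_const, Finset.card_univ, nsmul_eq_mul,
    ← mul_assoc, mul_one_div_cancel hc, one_mul]

theorem sum_channelLaw_rank (X : Matrix (Fin n) (Fin m) F) (r : ℕ) :
    ∑ Y : Matrix (Fin n) (Fin m) F, channelLaw R X Y * (if Y.rank = r then 1 else 0) =
      ∑ rB, R rB * ((f2 F n m r X.rank rB : ℝ) / numRank F n m rB) := by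
  rw [sum_channelLaw_mul]
  · rw [sum_ugr_ite (R := R) (fun B : Matrix (Fin n) (Fin m) F => (X + B).rank = r)]
    refine Finset.sum_congr rfl fun rB _ => ?_
    rw [← count2_eq_f2 r rB (X := X) rfl, count2]
  · intro A M
    rw [← mulEquiv_one_right, rank_mulEquiv]

theorem sum_outputDist_rank (P : Matrix (Fin n) (Fin m) F → ℝ) (r : ℕ) :
    ∑ Y : Matrix (Fin n) (Fin m) F, (if Y.rank = r then outputDist R P Y else 0) =
      outRank F n m R (rankDist P) r := by
  have h1 : ∀ Y : Matrix (Fin n) (Fin m) F, (if Y.rank = r then outputDist R P Y else 0) =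
      ∑ X, P X * (channelLaw R X Y * (if Y.rank = r then 1 else 0)) := by
    intro Y
    split_ifs <;> simp [outputDist]
  rw [Finset.sum_congr rfl fun Y _ => h1 Y, Finset.sum_comm]
  simp_rw [← Finset.mul_sum, sum_channelLaw_rank]
  have h2 := sum_mul_comp_rankFin P
    (fun rX => ∑ rB, R rB * ((f2 F n m r rX rB : ℝ) / numRank F n m rB))
  refine h2.trans ?_
  unfold outRank
  simp_rw [Finset.mul_sum, mul_assoc]

open Classical in
theorem sum_channelLaw_rowSpace (X : Matrix (Fin n) (Fin m) F) (V : Submodule F (Fin m → F)) :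
    ∑ Y : Matrix (Fin n) (Fin m) F, channelLaw R X Y * (if rowSpace Y = V then 1 else 0) =
      rowProb F n m R X.rank (finrank F V) (quotDim (rowSpace X) V) := by
  rw [sum_channelLaw_mul]
  · rw [sum_ugr_ite (R := R) (fun B : Matrix (Fin n) (Fin m) F => rowSpace (X + B) = V), rowProb]
    refine Finset.sum_congr rfl fun r _ => ?_
    rw [← count1_eq_f1 r (finrank_rowSpace X) rfl rfl, count1]
  · intro A M
    rw [rowSpace_mul]

theorem channelLaw_eq_of_rowSpace_eq (X : Matrix (Fin n) (Fin m) F)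
    {Y Y' : Matrix (Fin n) (Fin m) F} (h : rowSpace Y = rowSpace Y') :
    channelLaw R X Y = channelLaw R X Y' := by
  obtain ⟨A, rfl⟩ := exists_mul_eq_of_rowSpace_eq h
  have := channelLaw_mulEquiv (R := R) 1 A 1 X Y
  rw [mulEquiv_one_right, mulEquiv_one_right, Units.val_one, Matrix.one_mul] at this
  exact this.symm

/-- The law is constant on the matrices sharing the row space of `Y`, so this product is the total
probability of that row space. -/
theorem count0_mul_channelLaw (X Y : Matrix (Fin n) (Fin m) F) :
    (count0 F n m (rowSpace Y) : ℝ) * channelLaw R X Y =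
      rowProb F n m R X.rank (finrank F (rowSpace Y)) (quotDim (rowSpace X) (rowSpace Y)) := by
  classical
  rw [← sum_channelLaw_rowSpace, count0, natCard_subtype_eq_sum, Finset.sum_mul]
  refine Finset.sum_congr rfl fun Y' _ => ?_
  by_cases h : rowSpace Y' = rowSpace Y
  · rw [if_pos h, channelLaw_eq_of_rowSpace_eq X h, one_mul, mul_one]
  · rw [if_neg h, zero_mul, mul_zero]

theorem rowProb_eq_zero_of_forall_ne (X : Matrix (Fin n) (Fin m) F)
    {V : Submodule F (Fin m → F)} (h : ∀ Y : Matrix (Fin n) (Fin m) F, rowSpace Y ≠ V) :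
    rowProb F n m R X.rank (finrank F V) (quotDim (rowSpace X) V) = 0 := by
  classical
  rw [← sum_channelLaw_rowSpace]
  exact Finset.sum_eq_zero fun Y _ => by rw [if_neg (h Y), mul_zero]

open Classical in
theorem sum_channelLaw_mul_logb_rowSpace (b : ℝ) (X : Matrix (Fin n) (Fin m) F)
    (V : Submodule F (Fin m → F)) :
    ∑ Y : Matrix (Fin n) (Fin m) F,
        (if rowSpace Y = V then channelLaw R X Y * Real.logb b (channelLaw R X Y) else 0) =
      -(rowProb F n m R X.rank (finrank F V) (quotDim (rowSpace X) V) *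
        Real.logb b ((f0 F n m (finrank F V) : ℝ) /
          rowProb F n m R X.rank (finrank F V) (quotDim (rowSpace X) V))) := by
  by_cases hV : ∃ Y : Matrix (Fin n) (Fin m) F, rowSpace Y = V
  · obtain ⟨Y, rfl⟩ := hV
    have hc : (count0 F n m (rowSpace Y) : ℝ) ≠ 0 := by
      have : Nonempty {M : Matrix (Fin n) (Fin m) F // rowSpace M = rowSpace Y} := ⟨⟨Y, rfl⟩⟩
      exact Nat.cast_ne_zero.2 Nat.card_pos.ne'
    -- With the row space probability written as `f0` times the law, the argument of the logarithm
    -- becomes the reciprocal of the law.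
    rw [← count0_mul_channelLaw, ← count0_eq_f0 rfl, ← div_div, div_self hc, one_div,
      Real.logb_inv, mul_neg, neg_neg, count0, natCard_subtype_eq_sum, mul_assoc, Finset.sum_mul]
    refine Finset.sum_congr rfl fun Y' _ => ?_
    by_cases h : rowSpace Y' = rowSpace Y
    · rw [if_pos h, if_pos h, channelLaw_eq_of_rowSpace_eq X h, one_mul]
    · rw [if_neg h, if_neg h, zero_mul]
  · push Not at hV
    rw [rowProb_eq_zero_of_forall_ne X hV, zero_mul, neg_zero]
    exact Finset.sum_eq_zero fun Y _ => if_neg (hV Y)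

end Channel

/-! ### Entropy bounds, continuity and the comparison of the two maxima. -/

section Capacity

/-- Jensen's inequality for the concave function `-x log x` with equal weights; `1 < b` keeps its
direction in base `b`. -/
theorem sum_mul_logb_ge {α : Type*} (s : Finset α) {b : ℝ} (hb : 1 < b) {x : α → ℝ}
    (hx : ∀ i ∈ s, 0 ≤ x i) :
    (∑ i ∈ s, x i) * Real.logb b (1 / (s.card : ℝ) * ∑ i ∈ s, x i) ≤
      ∑ i ∈ s, x i * Real.logb b (x i) := by
  rcases s.eq_empty_or_nonempty with rfl | hs
  · simp
  have hc : (0 : ℝ) < s.card := Nat.cast_pos.2 hs.card_pos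
  have h := Real.concaveOn_negMulLog.le_map_sum (t := s) (w := fun _ => 1 / (s.card : ℝ)) (p := x)
    (fun i _ => by positivity) (by rw [Finset.sum_const, nsmul_eq_mul, mul_one_div_cancel hc.ne'])
    hx
  simp only [smul_eq_mul, ← Finset.mul_sum, Real.negMulLog, neg_mul, Finset.sum_neg_distrib,
    mul_neg, neg_le_neg_iff] at h
  rw [mul_assoc] at h
  have h1 := le_of_mul_le_mul_left h (by positivity)
  simp only [Real.logb, mul_div_assoc', ← Finset.sum_div]
  exact div_le_div_of_nonneg_right h1 (Real.log_pos hb).le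

theorem sum_mul_logb_eq_of_const {α : Type*} (s : Finset α) (b : ℝ) {x : α → ℝ}
    (hx : ∀ i ∈ s, ∀ j ∈ s, x i = x j) :
    ∑ i ∈ s, x i * Real.logb b (x i) =
      (∑ i ∈ s, x i) * Real.logb b (1 / (s.card : ℝ) * ∑ i ∈ s, x i) := by
  rcases s.eq_empty_or_nonempty with rfl | ⟨j, hj⟩
  · simp
  have hc : (s.card : ℝ) ≠ 0 := Nat.cast_ne_zero.2 (Finset.card_ne_zero_of_mem hj)
  rw [Finset.sum_congr rfl fun i hi => hx i hi j hj,
    Finset.sum_congr rfl fun i hi => by rw [hx i hi j hj], Finset.sum_const, Finset.sum_const,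
    nsmul_eq_mul, nsmul_eq_mul, one_div, inv_mul_cancel_left₀ hc, mul_assoc]

variable {F : Type*} [Field F] [Fintype F] {n m : ℕ} {R : Fin (min n m + 1) → ℝ}

theorem sum_eq_sum_rank (g : Matrix (Fin n) (Fin m) F → ℝ) :
    ∑ Y, g Y = ∑ r ∈ Finset.range (min n m + 1), ∑ Y with Y.rank = r, g Y :=
  (Finset.sum_fiberwise_of_maps_to (fun Y _ => Finset.mem_range.2 (rank_lt Y)) g).symm

theorem card_filter_rank (r : ℕ) :
    (Finset.univ.filter fun M : Matrix (Fin n) (Fin m) F => M.rank = r).card = numRank F n m r := by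
  rw [numRank, Nat.card_eq_fintype_card, Fintype.card_subtype]

theorem continuous_mul_logb_const_mul (b : ℝ) {c : ℝ} (hc : c ≠ 0) :
    Continuous fun x => x * Real.logb b (c * x) := by
  have h : (fun x => x * Real.logb b (c * x)) =
      fun x => c⁻¹ * ((c * x) * Real.log (c * x)) / Real.log b := by
    funext x
    rw [Real.logb]
    field_simp
  rw [h]
  exact (continuous_const.mul
    (Real.continuous_mul_log.comp (continuous_const.mul continuous_id))).div_const _

/-- The output rank distribution and the conditional entropy term are linear in `RX`; the
logarithmic term reduces to `x log x`, which is continuous at `0` too. -/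
theorem continuous_objective (b : ℝ) : Continuous (objective F n m b R) := by
  unfold objective
  refine (continuous_finsetSum _ fun r hr => ?_).neg.sub (continuous_finsetSum _ fun r _ => ?_)
  · have h1 : Continuous fun RX => outRank F n m R RX r := by
      unfold outRank
      fun_prop
    have hr' : (1 / (numRank F n m r : ℝ)) ≠ 0 :=
      one_div_ne_zero (Nat.cast_ne_zero.2 (numRank_pos ⟨r, Finset.mem_range.1 hr⟩).ne')
    exact (continuous_mul_logb_const_mul b hr').comp h1
  · fun_prop

variable [DecidableEq F]

variable (F n m) in
/-- The conditional entropy of the output given an input of rank `r`. -/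
def condEntropy (b : ℝ) (R : Fin (min n m + 1) → ℝ) (r : ℕ) : ℝ :=
  ∑ u ∈ Finset.range (min n m + 1), ∑ h ∈ Finset.range (r + 1),
    (Fintype.card F : ℝ) ^ (((u : ℤ) - r + h) * h) *
      gaussBinom (Fintype.card F) (m - r) ((u : ℤ) - r + h) *
      gaussBinom (Fintype.card F) r ((r : ℤ) - h) *
      (rowProb F n m R r u h * Real.logb b ((f0 F n m u : ℝ) / rowProb F n m R r u h))

open Classical in
theorem sum_channelLaw_mul_logb (b : ℝ) (X : Matrix (Fin n) (Fin m) F) :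
    ∑ Y, channelLaw R X Y * Real.logb b (channelLaw R X Y) = -condEntropy F n m b R X.rank := by
  have : Fintype (Submodule F (Fin m → F)) :=
    @Fintype.ofFinite _ (Finite.of_injective _ SetLike.coe_injective)
  let G : ℕ → ℕ → ℝ := fun u h => rowProb F n m R X.rank u h *
    Real.logb b ((f0 F n m u : ℝ) / rowProb F n m R X.rank u h)
  have h1 : ∑ Y, channelLaw R X Y * Real.logb b (channelLaw R X Y) =
      -∑ V : Submodule F (Fin m → F), G (finrank F V) (quotDim (rowSpace X) V) := by
    rw [← Finset.sum_neg_distrib,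
      ← Finset.sum_congr rfl fun V _ => sum_channelLaw_mul_logb_rowSpace (R := R) b X V,
      Finset.sum_comm]
    refine Finset.sum_congr rfl fun Y _ => ?_
    simp
  have h2 : ∀ V : Submodule F (Fin m → F), G (finrank F V) (quotDim (rowSpace X) V) =
      ∑ u ∈ Finset.range (min n m + 1), ∑ h ∈ Finset.range (X.rank + 1),
        (if finrank F V = u ∧ quotDim (rowSpace X) V = h then 1 else 0) * G u h := by
    intro V
    have h3 : quotDim (rowSpace X) V ∈ Finset.range (X.rank + 1) := by
      have := quotDim_add_finrank_inf (rowSpace X) V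
      rw [finrank_rowSpace] at this
      rw [Finset.mem_range]
      omega
    simp only [ite_and, ite_mul, one_mul, zero_mul]
    rw [Finset.sum_eq_single (finrank F V)]
    · simp only [if_true]
      rw [Finset.sum_ite_eq, if_pos h3]
    · intro u _ hu
      simp [hu.symm]
    -- A subspace whose dimension exceeds `min n m` is not a row space, so it has probability zero
    -- and truncating the sum over `u` loses nothing.
    · intro hu
      have h4 : ∀ Y : Matrix (Fin n) (Fin m) F, rowSpace Y ≠ V := by
        rintro Y rfl
        rw [finrank_rowSpace] at hu
        exact hu (Finset.mem_range.2 (rank_lt Y))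
      simp only [if_true]
      rw [Finset.sum_ite_eq, if_pos h3]
      simp only [G, rowProb_eq_zero_of_forall_ne X h4, zero_mul]
  rw [h1, Finset.sum_congr rfl fun V _ => h2 V, Finset.sum_comm, condEntropy]
  congr 1
  refine Finset.sum_congr rfl fun u _ => ?_
  rw [Finset.sum_comm]
  refine Finset.sum_congr rfl fun h hh => ?_
  rw [← Finset.sum_mul, ← natCard_subtype_eq_sum,
    card_submodule_quotDim (finrank_rowSpace X) u (Nat.lt_succ_iff.1 (Finset.mem_range.1 hh))]

theorem outputDist_nonneg (hR : ∀ r, 0 ≤ R r) {P : Matrix (Fin n) (Fin m) F → ℝ}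
    (hP : ∀ X, 0 ≤ P X) (Y : Matrix (Fin n) (Fin m) F) : 0 ≤ outputDist R P Y :=
  Finset.sum_nonneg fun X _ => mul_nonneg (hP X) (channelLaw_nonneg hR X Y)

theorem mutualInfo_eq (b : ℝ) (hR : ∀ r, 0 ≤ R r) {P : Matrix (Fin n) (Fin m) F → ℝ}
    (hP : ∀ X, 0 ≤ P X) :
    mutualInfo b R P = -(∑ Y, outputDist R P Y * Real.logb b (outputDist R P Y)) -
      ∑ r : Fin (min n m + 1), rankDist P r * condEntropy F n m b R r := by
  have h1 : ∀ X Y, (P X * channelLaw R X Y) *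
      Real.logb b ((P X * channelLaw R X Y) / (P X * outputDist R P Y)) =
      P X * (channelLaw R X Y * Real.logb b (channelLaw R X Y)) -
        P X * channelLaw R X Y * Real.logb b (outputDist R P Y) := by
    intro X Y
    -- A joint probability of zero kills both sides; otherwise the output probability is positive,
    -- `P X` cancels and the logarithm splits.
    by_cases h0 : P X * channelLaw R X Y = 0
    · rw [← mul_assoc, h0]
      ring
    · obtain ⟨hPX, hW⟩ := mul_ne_zero_iff.1 h0
      have hpos : 0 < outputDist R P Y :=
        lt_of_lt_of_le (lt_of_le_of_ne (mul_nonneg (hP X) (channelLaw_nonneg hR X Y)) (Ne.symm h0))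
          (Finset.single_le_sum (f := fun X => P X * channelLaw R X Y)
            (fun X _ => mul_nonneg (hP X) (channelLaw_nonneg hR X Y)) (Finset.mem_univ X))
      rw [mul_div_mul_left _ _ hPX, Real.logb_div hW hpos.ne']
      ring
  have h2 := sum_mul_comp_rankFin P (fun r => condEntropy F n m b R r)
  unfold mutualInfo
  simp_rw [h1, Finset.sum_sub_distrib, ← Finset.mul_sum, sum_channelLaw_mul_logb]
  rw [← h2, Finset.sum_comm (f := fun X Y => P X * channelLaw R X Y * _)]
  simp_rw [← Finset.sum_mul, mul_neg, Finset.sum_neg_distrib]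
  change -(∑ X, P X * condEntropy F n m b R X.rank) - ∑ Y, outputDist R P Y * _ =
    _ - ∑ X, P X * condEntropy F n m b R X.rank
  ring

theorem objective_rankDist (b : ℝ) (P : Matrix (Fin n) (Fin m) F → ℝ) :
    objective F n m b R (rankDist P) =
      -(∑ r ∈ Finset.range (min n m + 1), (∑ Y with Y.rank = r, outputDist R P Y) *
        Real.logb b (1 / ((Finset.univ.filter
          fun M : Matrix (Fin n) (Fin m) F => M.rank = r).card : ℝ) *
            ∑ Y with Y.rank = r, outputDist R P Y)) -
      ∑ r : Fin (min n m + 1), rankDist P r * condEntropy F n m b R r := by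
  simp_rw [card_filter_rank, Finset.sum_filter, sum_outputDist_rank]
  rfl

/-- Both sides have the same conditional entropy term, so only the output entropy is compared, one
rank class at a time. -/
theorem mutualInfo_le_objective {b : ℝ} (hb : 1 < b) (hR : ∀ r, 0 ≤ R r)
    {P : Matrix (Fin n) (Fin m) F → ℝ} (hP : ∀ X, 0 ≤ P X) :
    mutualInfo b R P ≤ objective F n m b R (rankDist P) := by
  rw [mutualInfo_eq b hR hP, objective_rankDist, sum_eq_sum_rank]
  exact sub_le_sub_right (neg_le_neg (Finset.sum_le_sum fun r _ =>
    sum_mul_logb_ge _ hb fun Y _ => outputDist_nonneg hR hP Y)) _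

theorem outputDist_ugr_mulEquiv (RX : Fin (min n m + 1) → ℝ) (A : GL (Fin n) F) (Q : GL (Fin m) F)
    (Y : Matrix (Fin n) (Fin m) F) :
    outputDist R (ugr RX) (mulEquiv A Q Y) = outputDist R (ugr RX) Y := by
  unfold outputDist
  rw [← Equiv.sum_comp (mulEquiv A Q)]
  simp_rw [ugr_mulEquiv, channelLaw_mulEquiv]

/-- The output law inherits the invariance of the input law, so it is constant on each rank class,
which is the equality case of the Jensen bound. -/
theorem mutualInfo_ugr (b : ℝ) (hR : ∀ r, 0 ≤ R r) {RX : Fin (min n m + 1) → ℝ}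
    (hRX : ∀ r, 0 ≤ RX r) :
    mutualInfo (F := F) b R (ugr RX) = objective F n m b R RX := by
  have h := objective_rankDist (F := F) (R := R) b (ugr RX)
  rw [rankDist_ugr] at h
  rw [h, mutualInfo_eq b hR (ugr_nonneg hRX), sum_eq_sum_rank, rankDist_ugr]
  congr 2
  refine Finset.sum_congr rfl fun r _ => sum_mul_logb_eq_of_const _ b fun Y hY Y' hY' => ?_
  rw [Finset.mem_filter] at hY hY'
  obtain ⟨A, Q, rfl⟩ := exists_mulEquiv_eq_of_rank_eq (hY.2.trans hY'.2.symm)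
  exact (outputDist_ugr_mulEquiv RX A Q Y).symm

/-- A maximizer `RX` of the objective on the simplex also yields an optimal input, `ugr RX`: no
input exceeds the objective at its own rank distribution. -/
theorem exists_isGreatest {b : ℝ} (hb : 1 < b) (hR : R ∈ rankDists n m) :
    ∃ C, IsGreatest (mutualInfoValues F n m b R) C ∧
      IsGreatest (objective F n m b R '' rankDists n m) C := by
  obtain ⟨RX, hRX, hmax⟩ := (isCompact_stdSimplex ℝ (Fin (min n m + 1))).exists_isMaxOn ⟨R, hR⟩
    (continuous_objective (F := F) (R := R) b).continuousOn
  refine ⟨objective F n m b R RX, ⟨⟨ugr RX, ugr_mem hRX, mutualInfo_ugr b hR.1 hRX.1⟩, ?_⟩,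
    ⟨RX, hRX, rfl⟩, ?_⟩
  · rintro _ ⟨P, hP, rfl⟩
    exact (mutualInfo_le_objective hb hR.1 hP.1).trans (hmax (rankDist_mem hP))
  · rintro _ ⟨RX', hRX', rfl⟩
    exact hmax hRX'

end Capacity

end GammaChannel

end

theorem corollary6p2 (F : Type*) [Field F] [Fintype F] [DecidableEq F] (n m : ℕ)
    (b : ℝ) (hb : 1 < b)
    (R : Fin (min n m + 1) → ℝ) (hR : R ∈ GammaChannel.rankDists n m) :
    -- the counting functions do not depend on the chosen subspaces and matrices
    (∀ (u : ℕ) (U : Submodule F (Fin m → F)), Module.finrank F U = u →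
      GammaChannel.count0 F n m U = GammaChannel.f0 F n m u) ∧
    (∀ (u v h r : ℕ) (M : Matrix (Fin n) (Fin m) F) (V : Submodule F (Fin m → F)),
      Module.finrank F (GammaChannel.rowSpace M) = u → Module.finrank F V = v →
      GammaChannel.quotDim (GammaChannel.rowSpace M) V = h →
      GammaChannel.count1 F n m M V r = GammaChannel.f1 F n m u v h r) ∧
    (∀ (r rX rB : ℕ) (X : Matrix (Fin n) (Fin m) F), X.rank = rX →
      GammaChannel.count2 F n m X r rB = GammaChannel.f2 F n m r rX rB) ∧
    -- the capacity is the maximum of the mutual information over all input distributions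
    IsGreatest (GammaChannel.mutualInfoValues F n m b R) (GammaChannel.capacity F n m b R) ∧
    -- the capacity is the maximum of the objective over all input rank distributions
    IsGreatest (GammaChannel.objective F n m b R '' GammaChannel.rankDists n m)
      (GammaChannel.capacity F n m b R) := by
  obtain ⟨C, h1, h2⟩ := GammaChannel.exists_isGreatest (F := F) hb hR
  have hC : GammaChannel.capacity F n m b R = C := h1.csSup_eq
  rw [hC]
  refine ⟨fun u U hU => GammaChannel.count0_eq_f0 hU,
    fun u v h r M V hM hV hMV => GammaChannel.count1_eq_f1 r hM hV hMV,
    fun r rX rB X hX => GammaChannel.count2_eq_f2 r rB hX, h1, h2⟩
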